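/- All multigraphs are finite; loops (counted twice in degrees) and parallel edges are allowed. A \emph{circle representation} of a multigraph $G$ is a collection of distinct circles of positive radius in $\mathbb{R}^2$ such that each point of the plane belongs to at most two of the circles, the set $P$ of points belonging to exactly two circles is in bijective correspondence with the vertex set of $G$, and the open circular arcs into which $P$ cuts the circles are in bijective correspondence with the edges of $G$, the end points of the arc of an edge being the points of $P$ that correspond to the ends of that edge. (A circle carrying exactly one point $p$ of $P$ gives a single arc from $p$ to $p$, which represents a loop.) A \emph{mini-gadget} with attaching vertex $w_i$ is a multigraph in which $w_i$ has degree $2$ and every other vertex has degree $4$. A \emph{mini-bigadget} with attaching vertices $w_i\neq w_i'$ is a multigraph in which $w_i$ and $w_i'$ have degree $2$ and every other vertex has degree $4$. Let $G$ be a $4$-regular planar multigraph. (Planarity of $G$ and of its subgraphs is automatic if $G$ has a circle representation.) A \emph{gadget-subgraph} of $G$ consists of two vertex-disjoint subgraphs $H_1,H_2$ of $G$ that are mini-gadgets with attaching vertices $w_1,w_2$, three distinct vertices $v_1,v_2,w$ of $G$ outside $H_1$ and $H_2$, and edges $v_iw_i$, $w_iw$, $v_iw$ of $G$ for $i=1,2$.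 A \emph{bigadget-subgraph} of $G$ consists of two vertex-disjoint subgraphs $H_1,H_2$ of $G$ that are mini-bigadgets with attaching vertices $w_i,w_i'$ ($i=1,2$), three distinct vertices $v_1,v_2,w$ of $G$ outside $H_1$ and $H_2$, and edges $v_iw_i$, $w_iw_i'$, $w_i'w$, $v_iw$ of $G$ for $i=1,2$, where the edge $w_iw_i'$ does not belong to $H_i$. Given a gadget-subgraph or a bigadget-subgraph of $G$, let $G'$ be the multigraph obtained from $G$ by removing all vertices of $H_1$ and $H_2$ together with all incident edges, and adding one new (possibly parallel) edge between $v_i$ and $w$ for each of $i=1,2$. If $G$ has a circle representation, then so does $G'$. -/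

import Mathlib

/-!
Multigraphs are Mathlib's `Graph α β` (vertices in `α`, edges in `β`, loops and parallel edges
allowed).  The plane is `ℂ`, with its Euclidean distance; a circle is an
`EuclideanGeometry.Sphere ℂ` of positive radius.
-/

namespace CircleRep

/-- The points lying on at least two different circles of the collection `𝒞`. -/
def doublePoints (𝒞 : Set (EuclideanGeometry.Sphere ℂ)) : Set ℂ :=
  {p | ∃ C ∈ 𝒞, ∃ D ∈ 𝒞, C ≠ D ∧ p ∈ C ∧ p ∈ D}

/-- `A` is one of the (open) circular arcs into which the double points cut the circles of `𝒞`,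
and it runs counterclockwise from the double point `p` to the double point `q`.
If a circle carries exactly one double point `p`, its only arc is the whole circle
without `p`, and it runs from `p` to `p` (`b = a + 2π`). -/
def IsArc (𝒞 : Set (EuclideanGeometry.Sphere ℂ)) (A : Set ℂ) (p q : ℂ) : Prop :=
  ∃ C ∈ 𝒞, ∃ a b : ℝ, a < b ∧ b ≤ a + 2 * Real.pi ∧
    circleMap C.center C.radius a = p ∧ circleMap C.center C.radius b = q ∧
    p ∈ doublePoints 𝒞 ∧ q ∈ doublePoints 𝒞 ∧
    A = circleMap C.center C.radius '' Set.Ioo a b ∧ Disjoint A (doublePoints 𝒞)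

end CircleRep

namespace Graph

variable {α β : Type*}

/-- The degree of a vertex in a multigraph: loops count twice. -/
noncomputable def multiDegree (G : Graph α β) (x : α) : ℕ∞ :=
  (G.incidenceSet x).encard + (G.loopSet x).encard

/-- Every vertex has degree `4`. -/
def IsFourRegular (G : Graph α β) : Prop :=
  ∀ x ∈ G.vertexSet, G.multiDegree x = 4

/-- A circle representation of the multigraph `G`. -/
structure CircleRepresentation (G : Graph α β) where
  /-- The collection of circles. -/
  circles : Set (EuclideanGeometry.Sphere ℂ)
  radius_pos : ∀ C ∈ circles, 0 < C.radius
  /-- Each point of the plane belongs to at most two circles. -/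
  at_most_two : ∀ p : ℂ, {C | C ∈ circles ∧ p ∈ C}.encard ≤ 2
  /-- The points on two circles correspond bijectively to the vertices. -/
  vertexPoint : α → ℂ
  vertexPoint_bijOn : Set.BijOn vertexPoint G.vertexSet (CircleRep.doublePoints circles)
  /-- The arcs between those points correspond bijectively to the edges. -/
  edgeArc : β → Set ℂ
  edgeArc_bijOn : Set.BijOn edgeArc G.edgeSet {A | ∃ p q, CircleRep.IsArc circles A p q}
  /-- The ends of the arc of an edge are the points of the ends of that edge. -/
  isArc_of_isLink : ∀ e x y, G.IsLink e x y →
    CircleRep.IsArc circles (edgeArc e) (vertexPoint x) (vertexPoint y) ∨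
    CircleRep.IsArc circles (edgeArc e) (vertexPoint y) (vertexPoint x)

/-- `G` admits a circle representation. -/
def CircleRepresentable (G : Graph α β) : Prop := Nonempty G.CircleRepresentation

/-- A mini-gadget with attaching vertex `c`: all degrees are `4`, except that `c` has degree `2`.
(Planarity is not demanded here: it holds for every subgraph of a graph that has a
circle representation.) -/
structure IsMiniGadget (H : Graph α β) (c : α) : Prop where
  mem : c ∈ H.vertexSet
  degree_attach : H.multiDegree c = 2
  degree_other : ∀ x ∈ H.vertexSet, x ≠ c → H.multiDegree x = 4

/-- A mini-bigadget with attaching vertices `c ≠ c'`: all degrees are `4`, except that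
`c` and `c'` have degree `2`.  The edge that joins `c` to `c'` in a bigadget-subgraph
is not counted as part of the mini-bigadget. -/
structure IsMiniBigadget (H : Graph α β) (c c' : α) : Prop where
  ne : c ≠ c'
  mem : c ∈ H.vertexSet
  mem' : c' ∈ H.vertexSet
  degree_attach : H.multiDegree c = 2
  degree_attach' : H.multiDegree c' = 2
  degree_other : ∀ x ∈ H.vertexSet, x ≠ c → x ≠ c' → H.multiDegree x = 4

/-- What the two kinds of gadget share: `H 0` and `H 1` are vertex-disjoint subgraphs of `G`,
the vertices `v 0`, `v 1`, `w` are distinct and lie outside both, and `v i` is adjacent to `w`. -/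
structure IsGadgetFrame (G : Graph α β) (w : α) (v : Fin 2 → α) (H : Fin 2 → Graph α β) :
    Prop where
  le : ∀ i, H i ≤ G
  disjoint : Disjoint (H 0).vertexSet (H 1).vertexSet
  v_ne : v 0 ≠ v 1
  v_ne_w : ∀ i, v i ≠ w
  v_notMem : ∀ i j, v i ∉ (H j).vertexSet
  w_notMem : ∀ j, w ∉ (H j).vertexSet
  adj_v_w : ∀ i, G.Adj (v i) w

/-- A gadget-subgraph of `G`: besides the edges `v i — w` and two mini-gadgets `H i` with
attaching vertices `c i`, it has the edges `v i — c i` and `c i — w`. -/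
structure IsGadgetSubgraph (G : Graph α β) (w : α) (v c : Fin 2 → α) (H : Fin 2 → Graph α β) :
    Prop extends IsGadgetFrame G w v H where
  mini : ∀ i, (H i).IsMiniGadget (c i)
  adj_v_c : ∀ i, G.Adj (v i) (c i)
  adj_c_w : ∀ i, G.Adj (c i) w

/-- A bigadget-subgraph of `G`: besides the edges `v i — w` and two mini-bigadgets `H i` with
attaching vertices `c i`, `c' i`, it has the edges `v i — c i`, `c i — c' i` and `c' i — w`,
where the edge `c i — c' i` is not an edge of `H i`. -/
structure IsBigadgetSubgraph (G : Graph α β) (w : α) (v c c' : Fin 2 → α)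
    (H : Fin 2 → Graph α β) : Prop extends IsGadgetFrame G w v H where
  mini : ∀ i, (H i).IsMiniBigadget (c i) (c' i)
  adj_v_c : ∀ i, G.Adj (v i) (c i)
  link_c_c' : ∀ i, ∃ e, e ∉ (H i).edgeSet ∧ G.IsLink e (c i) (c' i)
  adj_c'_w : ∀ i, G.Adj (c' i) w

/-- The multigraph `K` with two new edges: `Sum.inr i` joins `v i` to `w`, whether or not
these vertices are already adjacent. -/
def addTwoEdges (K : Graph α β) (w : α) (v : Fin 2 → α) : Graph α (β ⊕ Fin 2) where
  vertexSet := K.vertexSet ∪ ({w} ∪ Set.range v)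
  IsLink e x y := match e with
    | Sum.inl e => K.IsLink e x y
    | Sum.inr i => (x = v i ∧ y = w) ∨ (x = w ∧ y = v i)
  isLink_symm := by
    rintro (e | i) -
    · exact ⟨fun x y h => h.symm⟩
    · exact ⟨fun x y h => by tauto⟩
  eq_or_eq_of_isLink_of_isLink := by
    rintro (e | i) x y x' y' h h'
    · exact h.left_eq_or_eq h'
    · rcases h with ⟨rfl, rfl⟩ | ⟨rfl, rfl⟩ <;> rcases h' with ⟨rfl, rfl⟩ | ⟨rfl, rfl⟩ <;> simp
  left_mem_of_isLink := by
    rintro (e | i) x y h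
    · exact Or.inl h.left_mem
    · rcases h with ⟨rfl, rfl⟩ | ⟨rfl, rfl⟩ <;> simp

/-- Remove all vertices of `H 0` and `H 1` with all incident edges, and add
the edges `v i — w`. -/
def prune (G : Graph α β) (w : α) (v : Fin 2 → α) (H : Fin 2 → Graph α β) :
    Graph α (β ⊕ Fin 2) :=
  (G.deleteVerts ((H 0).vertexSet ∪ (H 1).vertexSet)).addTwoEdges w v

end Graph

/-! Let `S i` be the vertex set of `H i`. Counting degrees in the 4-regular graph shows that only
two edges leave `S i`, one towards `v i` and one towards `w` (`IsTwoEdgeCut`). A circle through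
vertices both inside and outside `S i` has to enter `S i` and leave it again, so it uses both cut
edges: its stretch around the inner vertices runs from `v i` to `w` and contains the arc of the edge
at `v i` (`exists_gap_through`).

An arc lies on a single circle, so only one circle crosses between `S i` and the rest. Delete every
circle that carries no vertex outside both gadgets. Each vertex point of `S i` then lies on at most
one remaining circle and stops being a double point. The stretch through `S i` becomes a single arc
between `v i` and `w`, which represents the new edge; arcs between outer vertices are unchanged
(`circleRepresentable_prune`). -/

namespace CircleRep

open Set EuclideanGeometry

/-! ### Angles and points on a circle -/

/-- The point at angle `t` of a circle. -/
noncomputable abbrev pt (C : Sphere ℂ) (t : ℝ) : ℂ := circleMap C.center C.radius t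

theorem pt_mem {C : Sphere ℂ} (hC : 0 < C.radius) (t : ℝ) : pt C t ∈ C := by
  rw [EuclideanGeometry.mem_sphere]
  exact Metric.mem_sphere.1 (circleMap_mem_sphere C.center hC.le t)

theorem exists_pt_eq {C : Sphere ℂ} (hC : 0 < C.radius) {p : ℂ} (hp : p ∈ C) (s : ℝ) :
    ∃ t ∈ Ioc s (s + 2 * Real.pi), pt C t = p := by
  have h : p ∈ range (circleMap C.center C.radius) := by
    rw [range_circleMap, abs_of_pos hC]
    exact hp
  obtain ⟨t, rfl⟩ := h
  obtain ⟨t', ht', h⟩ := (periodic_circleMap C.center C.radius).exists_mem_Ioc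
    Real.two_pi_pos t s
  exact ⟨t', ht', h.symm⟩

theorem pt_add_sub {C : Sphere ℂ} (hC : 0 < C.radius) {t t' : ℝ} (h : pt C t = pt C t') (x : ℝ) :
    pt C (x + (t' - t)) = pt C x := by
  obtain ⟨n, hn⟩ := (circleMap_eq_circleMap_iff C.center hC.ne').1 h.symm
  refine (circleMap_eq_circleMap_iff C.center hC.ne').2 ⟨n, ?_⟩
  push_cast
  linear_combination hn

/-- Only finitely many angles in one half-open turn hit `X`; the smallest is taken. The turn
includes `s + 2π`, so that the only point of `X` on a circle is its own successor. -/
theorem exists_next {X : Set ℂ} (hX : X.Finite) {C : Sphere ℂ} (hC : 0 < C.radius)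
    (hd : ∃ d ∈ X, d ∈ C) (s : ℝ) :
    ∃ b, s < b ∧ b ≤ s + 2 * Real.pi ∧ pt C b ∈ X ∧ ∀ t ∈ Ioo s b, pt C t ∉ X := by
  obtain ⟨d, hdX, hdC⟩ := hd
  obtain ⟨t₀, ht₀, rfl⟩ := exists_pt_eq hC hdC s
  have hinj : (Ioc s (s + 2 * Real.pi)).InjOn (pt C) := by
    have := injOn_circleMap_of_abs_sub_le (a := s) (b := s + 2 * Real.pi) (c := C.center) hC.ne'
      (by simp [abs_of_pos Real.pi_pos])
    rwa [uIoc_of_le (by linarith [Real.pi_pos])] at this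
  have hfin : (Ioc s (s + 2 * Real.pi) ∩ pt C ⁻¹' X).Finite :=
    Finite.of_finite_image (hX.subset (by rintro _ ⟨t, ht, rfl⟩; exact ht.2))
      (hinj.mono inter_subset_left)
  obtain ⟨b, hb, hmin⟩ := exists_min_image _ id hfin ⟨t₀, ht₀, hdX⟩
  refine ⟨b, hb.1.1, hb.1.2, hb.2, fun t ht htX => ?_⟩
  exact (hmin t ⟨⟨ht.1, ht.2.le.trans hb.1.2⟩, htX⟩).not_gt ht.2

theorem exists_prev {X : Set ℂ} (hX : X.Finite) {C : Sphere ℂ} (hC : 0 < C.radius)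
    (hd : ∃ d ∈ X, d ∈ C) (s : ℝ) :
    ∃ a, a < s ∧ pt C a ∈ X ∧ ∀ t ∈ Ioo a s, pt C t ∉ X := by
  obtain ⟨d, hdX, hdC⟩ := hd
  obtain ⟨t₀, ht₀, rfl⟩ := exists_pt_eq hC hdC (s - 2 * Real.pi)
  rw [sub_add_cancel] at ht₀
  have hinj : (Ico (s - 2 * Real.pi) s).InjOn (pt C) :=
    injOn_circleMap_of_abs_sub_le' hC.ne' (by linarith)
  have hfin : (Ico (s - 2 * Real.pi) s ∩ pt C ⁻¹' X).Finite :=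
    Finite.of_finite_image (hX.subset (by rintro _ ⟨t, ht, rfl⟩; exact ht.2))
      (hinj.mono inter_subset_left)
  have hne : (Ico (s - 2 * Real.pi) s ∩ pt C ⁻¹' X).Nonempty := by
    rcases ht₀.2.lt_or_eq with h | h
    · exact ⟨t₀, ⟨ht₀.1.le, h⟩, hdX⟩
    -- If the angle found is `s` itself, one full turn earlier serves instead.
    · refine ⟨s - 2 * Real.pi, ⟨le_rfl, by linarith [Real.pi_pos]⟩, ?_⟩
      have := (periodic_circleMap C.center C.radius).sub_eq s
      rw [mem_preimage]
      change circleMap _ _ _ ∈ X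
      rw [this, ← h]
      exact hdX
  obtain ⟨a, ha, hmax⟩ := exists_max_image _ id hfin hne
  refine ⟨a, ha.1.2, ha.2, fun t ht htX => ?_⟩
  exact (hmax t ⟨⟨ha.1.1.trans ht.1.le, ht.2⟩, htX⟩).not_gt ht.1

/-! ### Arcs between consecutive points -/

/-- The angles `a < b` are those of consecutive points of `X` on the circle `C`. -/
structure IsGap (X : Set ℂ) (C : Sphere ℂ) (a b : ℝ) : Prop where
  lt : a < b
  le : b ≤ a + 2 * Real.pi
  left_mem : pt C a ∈ X
  right_mem : pt C b ∈ X
  notMem : ∀ t ∈ Ioo a b, pt C t ∉ X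

/-- The bound by one turn is automatic: otherwise `a + 2π` would be an interior angle of a point of
`X`. -/
theorem IsGap.of_lt {X : Set ℂ} {C : Sphere ℂ} {a b : ℝ} (hlt : a < b) (ha : pt C a ∈ X)
    (hb : pt C b ∈ X) (h : ∀ t ∈ Ioo a b, pt C t ∉ X) : IsGap X C a b := by
  refine ⟨hlt, not_lt.1 fun hlt' => ?_, ha, hb, h⟩
  refine h (a + 2 * Real.pi) ⟨by linarith [Real.pi_pos], hlt'⟩ ?_
  rwa [pt, periodic_circleMap]

/-- The arc of the circle `C` between two angles. -/
noncomputable abbrev arc (C : Sphere ℂ) (a b : ℝ) : Set ℂ := pt C '' Ioo a b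

theorem IsGap.arc_nonempty {X : Set ℂ} {C : Sphere ℂ} {a b : ℝ} (h : IsGap X C a b) :
    (arc C a b).Nonempty :=
  (nonempty_Ioo.2 h.lt).image _

theorem isArc_iff {𝒞 : Set (Sphere ℂ)} {A : Set ℂ} {p q : ℂ} :
    IsArc 𝒞 A p q ↔ ∃ C ∈ 𝒞, ∃ a b, IsGap (doublePoints 𝒞) C a b ∧ pt C a = p ∧ pt C b = q ∧
      A = arc C a b := by
  constructor
  · rintro ⟨C, hC, a, b, hlt, hle, rfl, rfl, hp, hq, rfl, hdis⟩
    exact ⟨C, hC, a, b, ⟨hlt, hle, hp, hq, fun t ht => disjoint_left.1 hdis ⟨t, ht, rfl⟩⟩,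
      rfl, rfl, rfl⟩
  · rintro ⟨C, hC, a, b, h, rfl, rfl, rfl⟩
    refine ⟨C, hC, a, b, h.lt, h.le, rfl, rfl, h.left_mem, h.right_mem, rfl, ?_⟩
    rw [disjoint_left]
    rintro _ ⟨t, ht, rfl⟩
    exact h.notMem t ht

theorem IsArc.disjoint {𝒞 : Set (Sphere ℂ)} {A : Set ℂ} {p q : ℂ} (h : IsArc 𝒞 A p q) :
    Disjoint A (doublePoints 𝒞) := by
  obtain ⟨C, hC, a, b, -, -, -, -, -, -, -, h⟩ := h
  exact h

theorem IsArc.nonempty {𝒞 : Set (Sphere ℂ)} {A : Set ℂ} {p q : ℂ} (h : IsArc 𝒞 A p q) :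
    A.Nonempty := by
  obtain ⟨C, hC, a, b, hgap, -, -, rfl⟩ := isArc_iff.1 h
  exact hgap.arc_nonempty

theorem IsGap.eq_of_mem {X : Set ℂ} {C : Sphere ℂ} {a b a' b' t : ℝ} (h : IsGap X C a b)
    (h' : IsGap X C a' b') (ht : t ∈ Ioo a b) (ht' : t ∈ Ioo a' b') : a = a' ∧ b = b' := by
  refine ⟨le_antisymm (not_lt.1 fun hlt => ?_) (not_lt.1 fun hlt => ?_),
    le_antisymm (not_lt.1 fun hlt => ?_) (not_lt.1 fun hlt => ?_)⟩
  · exact h'.notMem a ⟨hlt, ht.1.trans ht'.2⟩ h.left_mem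
  · exact h.notMem a' ⟨hlt, ht'.1.trans ht.2⟩ h'.left_mem
  · exact h.notMem b' ⟨ht.1.trans ht'.2, hlt⟩ h'.right_mem
  · exact h'.notMem b ⟨ht'.1.trans ht.2, hlt⟩ h.right_mem

/-- Two arcs with a common point are equal and have the same ends. -/
theorem IsArc.eq_of_mem {𝒞 : Set (Sphere ℂ)} (hpos : ∀ C ∈ 𝒞, 0 < C.radius) {A A' : Set ℂ}
    {p q p' q' z : ℂ} (h : IsArc 𝒞 A p q) (h' : IsArc 𝒞 A' p' q') (hz : z ∈ A) (hz' : z ∈ A') :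
    A = A' ∧ p = p' ∧ q = q' := by
  obtain ⟨C, hC, a, b, hg, rfl, rfl, rfl⟩ := isArc_iff.1 h
  obtain ⟨C', hC', a', b', hg', rfl, rfl, rfl⟩ := isArc_iff.1 h'
  obtain ⟨t, ht, rfl⟩ := hz
  obtain ⟨t', ht', hzt⟩ := hz'
  -- A common point of two different circles would be a double point, and arcs contain none.
  obtain rfl : C = C' := by
    by_contra hne
    refine hg.notMem t ht ⟨C, hC, C', hC', hne, pt_mem (hpos C hC) t, ?_⟩
    rw [← hzt]
    exact pt_mem (hpos C' hC') t'
  have hadd := pt_add_sub (hpos C hC) hzt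
  -- Shifting by `t - t'` gives the common point the same angle in both gaps.
  have hg'' : IsGap (doublePoints 𝒞) C (a' + (t - t')) (b' + (t - t')) := by
    refine .of_lt (by linarith [hg'.lt]) ?_ ?_ fun x hx => ?_
    · rw [hadd]; exact hg'.left_mem
    · rw [hadd]; exact hg'.right_mem
    · have := hg'.notMem (x - (t - t')) ⟨by linarith [hx.1], by linarith [hx.2]⟩
      rwa [← hadd, sub_add_cancel] at this
  obtain ⟨rfl, rfl⟩ := hg.eq_of_mem hg'' ht ⟨by linarith [ht'.1], by linarith [ht'.2]⟩
  refine ⟨?_, hadd a', hadd b'⟩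
  rw [arc, ← image_add_const_Ioo, image_image]
  exact image_congr fun x _ => hadd x

end CircleRep

/-! ### Circles that cross a two-edge cut -/

namespace Graph

open Set EuclideanGeometry CircleRep

variable {α β : Type*} {G : Graph α β}

/-- The only edges of `G` between `S` and its complement are the edge `e`, with outer end `v`,
and possibly the edge `f`, with outer end `w`. -/
structure IsTwoEdgeCut (G : Graph α β) (S : Set α) (v w : α) (e f : β) : Prop where
  subset : S ⊆ G.vertexSet
  exists_isLink : ∃ x ∈ S, G.IsLink e x v
  eq_or_eq : ∀ ⦃g x y⦄, G.IsLink g x y → x ∈ S → y ∉ S → (g = e ∧ y = v) ∨ (g = f ∧ y = w)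

namespace CircleRepresentation

variable (R : G.CircleRepresentation)

theorem finite_doublePoints (hfin : G.vertexSet.Finite) : (doublePoints R.circles).Finite := by
  rw [← R.vertexPoint_bijOn.image_eq]
  exact hfin.image _

theorem exists_isLink_of_isGap {C : Sphere ℂ} (hC : C ∈ R.circles) {a b : ℝ}
    (h : IsGap (doublePoints R.circles) C a b) :
    ∃ e x y, G.IsLink e x y ∧ R.edgeArc e = arc C a b ∧ R.vertexPoint x = pt C a ∧
      R.vertexPoint y = pt C b := by
  have harc : IsArc R.circles (arc C a b) (pt C a) (pt C b) :=
    isArc_iff.2 ⟨C, hC, a, b, h, rfl, rfl, rfl⟩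
  obtain ⟨e, he, hea⟩ := R.edgeArc_bijOn.surjOn ⟨_, _, harc⟩
  obtain ⟨x, y, hxy⟩ := exists_isLink_of_mem_edgeSet he
  obtain ⟨z, hz⟩ := h.arc_nonempty
  rcases R.isArc_of_isLink e x y hxy with h' | h'
  · obtain ⟨-, h1, h2⟩ := h'.eq_of_mem R.radius_pos harc (hea ▸ hz) hz
    exact ⟨e, x, y, hxy, hea, h1, h2⟩
  · obtain ⟨-, h1, h2⟩ := h'.eq_of_mem R.radius_pos harc (hea ▸ hz) hz
    exact ⟨e, y, x, hxy.symm, hea, h1, h2⟩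

theorem vertexPoint_mem_image_iff {S : Set α} (hS : S ⊆ G.vertexSet) {x : α}
    (hx : x ∈ G.vertexSet) : R.vertexPoint x ∈ R.vertexPoint '' S ↔ x ∈ S :=
  R.vertexPoint_bijOn.injOn.mem_image_iff hS hx

/-- A circle that passes through vertices inside and outside of `S` contains an arc that runs
inside `S` between the two outer ends of the edge cut. -/
theorem exists_gap_through (hfin : G.vertexSet.Finite) {S : Set α} {v w : α} {e f : β}
    (hcut : G.IsTwoEdgeCut S v w e f) {C : Sphere ℂ} (hC : C ∈ R.circles)
    (hout : ∃ d ∈ doublePoints R.circles \ R.vertexPoint '' S, d ∈ C) {s : ℝ}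
    (hs : pt C s ∈ R.vertexPoint '' S) :
    ∃ a b, s ∈ Ioo a b ∧ IsGap (doublePoints R.circles \ R.vertexPoint '' S) C a b ∧
      ((pt C a = R.vertexPoint v ∧ pt C b = R.vertexPoint w) ∨
        (pt C a = R.vertexPoint w ∧ pt C b = R.vertexPoint v)) ∧
      R.edgeArc e ⊆ arc C a b := by
  have hpos := R.radius_pos C hC
  have hD := R.finite_doublePoints hfin
  have hYD : R.vertexPoint '' S ⊆ doublePoints R.circles :=
    (image_mono hcut.subset).trans R.vertexPoint_bijOn.image_eq.subset
  obtain ⟨b, hsb, -, hbX, hb⟩ := exists_next (hD.sdiff) hpos hout s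
  obtain ⟨a, has, haX, ha⟩ := exists_prev (hD.sdiff) hpos hout s
  have hgap : IsGap (doublePoints R.circles \ R.vertexPoint '' S) C a b := by
    refine .of_lt (has.trans hsb) haX hbX fun t ht => ?_
    rcases lt_trichotomy t s with h | rfl | h
    · exact ha t ⟨ht.1, h⟩
    · exact fun h => h.2 hs
    · exact hb t ⟨h, ht.2⟩
  have hmem : ∃ d ∈ doublePoints R.circles, d ∈ C := ⟨_, hYD hs, pt_mem hpos s⟩
  -- `s₁` and `s₀` are the first and last double points strictly between `a` and `b`. They belong to
  -- `S`, so the arcs from `a` to `s₁` and from `s₀` to `b` are cut edges.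
  obtain ⟨s₁, has₁, -, hs₁D, hs₁⟩ := exists_next hD hpos hmem a
  obtain ⟨s₀, hs₀b, hs₀D, hs₀⟩ := exists_prev hD hpos hmem b
  have h1 : s₁ ≤ s := not_lt.1 fun h => hs₁ s ⟨has, h⟩ (hYD hs)
  have h0 : s ≤ s₀ := not_lt.1 fun h => hs₀ s ⟨h, hsb⟩ (hYD hs)
  have hin : ∀ t ∈ Ioo a b, pt C t ∈ doublePoints R.circles → pt C t ∈ R.vertexPoint '' S :=
    fun t ht htD => by_contra fun h => hgap.notMem t ht ⟨htD, h⟩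
  have hs₁Y := hin s₁ ⟨has₁, h1.trans_lt hsb⟩ hs₁D
  have hs₀Y := hin s₀ ⟨has.trans_le h0, hs₀b⟩ hs₀D
  obtain ⟨g₁, x₁, y₁, hl₁, hg₁, hx₁, hy₁⟩ :=
    R.exists_isLink_of_isGap hC (.of_lt has₁ haX.1 hs₁D hs₁)
  obtain ⟨g₀, y₀, x₀, hl₀, hg₀, hy₀, hx₀⟩ :=
    R.exists_isLink_of_isGap hC (.of_lt hs₀b hs₀D hbX.1 hs₀)
  have hy₁S : y₁ ∈ S := by
    rwa [← R.vertexPoint_mem_image_iff hcut.subset hl₁.right_mem, hy₁]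
  have hy₀S : y₀ ∈ S := by
    rwa [← R.vertexPoint_mem_image_iff hcut.subset hl₀.left_mem, hy₀]
  have hx₁S : x₁ ∉ S := by
    rw [← R.vertexPoint_mem_image_iff hcut.subset hl₁.left_mem, hx₁]
    exact haX.2
  have hx₀S : x₀ ∉ S := by
    rw [← R.vertexPoint_mem_image_iff hcut.subset hl₀.right_mem, hx₀]
    exact hbX.2
  -- The two arcs have disjoint angle ranges within a single turn, so they share no point; hence one
  -- of them is `e` and the other `f`.
  have hne : g₁ ≠ g₀ := by
    rintro rfl
    obtain ⟨m, hm⟩ := exists_between has₁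
    have hm' : pt C m ∈ arc C s₀ b := by
      rw [← hg₀, hg₁]
      exact ⟨m, hm, rfl⟩
    obtain ⟨m', hm', heq⟩ := hm'
    have := eq_of_circleMap_eq hpos.ne' (abs_lt.2
      ⟨by linarith [hm'.1, hm.2, hm.1, hm'.2, hgap.le, Real.pi_pos],
        by linarith [hm'.1, hm.2, hm.1, hm'.2, hgap.le]⟩) heq
    linarith [hm'.1, hm.2]
  have hsub₁ : R.edgeArc g₁ ⊆ arc C a b := by
    rw [hg₁]
    exact image_mono (Ioo_subset_Ioo_right (h1.trans hsb.le))
  have hsub₀ : R.edgeArc g₀ ⊆ arc C a b := by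
    rw [hg₀]
    exact image_mono (Ioo_subset_Ioo_left (has.le.trans h0))
  refine ⟨a, b, ⟨has, hsb⟩, hgap, ?_⟩
  rw [← hx₁, ← hx₀]
  rcases hcut.eq_or_eq hl₁.symm hy₁S hx₁S with ⟨rfl, rfl⟩ | ⟨rfl, rfl⟩ <;>
    rcases hcut.eq_or_eq hl₀ hy₀S hx₀S with ⟨rfl, rfl⟩ | ⟨rfl, rfl⟩
  · exact absurd rfl hne
  · exact ⟨.inl ⟨rfl, rfl⟩, hsub₁⟩
  · exact ⟨.inr ⟨rfl, rfl⟩, hsub₀⟩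
  · exact absurd rfl hne

end CircleRepresentation

/-! ### Edge cuts from degree counting -/

/-- The edges of `H` and `F` already use up the degree at `x`: loops of `H` are loops of `G`, so one
more incident edge would force degree at least `5`. -/
theorem incidenceSet_subset_of_multiDegree {H : Graph α β} (hle : H ≤ G) {x : α} {F : Set β}
    (hF : F ⊆ G.incidenceSet x) (hFH : Disjoint F H.edgeSet) (hG : G.multiDegree x = 4)
    (hH : H.multiDegree x + F.encard = 4) : G.incidenceSet x ⊆ H.incidenceSet x ∪ F := by
  by_contra hnot
  obtain ⟨g, hg, hgn⟩ := not_subset.1 hnot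
  have hinc : H.incidenceSet x ⊆ G.incidenceSet x := fun e he => Inc.mono hle he
  have hloop : H.loopSet x ⊆ G.loopSet x := fun e he => IsLoopAt.mono hle he
  have hsub : insert g (H.incidenceSet x ∪ F) ⊆ G.incidenceSet x :=
    insert_subset hg (union_subset hinc hF)
  have h1 := encard_le_encard hsub
  rw [encard_insert_of_notMem hgn, encard_union_eq
    (hFH.symm.mono_left (H.incidenceSet_subset_edgeSet x))] at h1
  have h2 := add_le_add h1 (encard_le_encard hloop)
  unfold multiDegree at hG hH
  rw [hG] at h2
  have h3 : (4 : ℕ∞) + 1 ≤ 4 := by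
    refine le_of_eq_of_le ?_ h2
    rw [← hH]
    ring
  exact absurd h3 (by decide)

theorem IsLink.mem_of_mem_incidenceSet {H : Graph α β} (hle : H ≤ G) {g : β} {x y z : α}
    (h : G.IsLink g x y) (hg : g ∈ H.incidenceSet z) : y ∈ H.vertexSet := by
  have hE := H.incidenceSet_subset_edgeSet z hg
  exact ((IsSubgraph.isLink_iff hle hE).2 h).right_mem

theorem IsLink.notMem_edgeSet {H : Graph α β} (hle : H ≤ G) {g : β} {x y : α}
    (h : G.IsLink g x y) (hy : y ∉ H.vertexSet) : g ∉ H.edgeSet :=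
  fun hE => hy ((IsSubgraph.isLink_iff hle hE).2 h).right_mem

/-- The two places that `H` leaves free at `c` are taken by the edges to `v` and `w`, which differ
because `v ≠ w`. No other vertex of `H` has a free place. -/
theorem IsMiniGadget.exists_isTwoEdgeCut {H : Graph α β} {c v w : α} (h4 : G.IsFourRegular)
    (hH : H.IsMiniGadget c) (hle : H ≤ G) (hv : v ∉ H.vertexSet) (hw : w ∉ H.vertexSet)
    (hvw : v ≠ w) (hvc : G.Adj v c) (hcw : G.Adj c w) :
    ∃ e f, G.IsTwoEdgeCut H.vertexSet v w e f := by
  obtain ⟨e, he⟩ := hvc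
  obtain ⟨f, hf⟩ := hcw
  have hef : e ≠ f := by
    rintro rfl
    exact hvw (he.symm.right_unique hf)
  refine ⟨e, f, hle.vertexSet_mono, ⟨c, hH.mem, he.symm⟩, fun g x y hg hx hy => ?_⟩
  have hxG := h4 x hg.left_mem
  by_cases hxc : x = c
  · subst hxc
    have := incidenceSet_subset_of_multiDegree (F := {e, f}) hle
      (by rintro _ (rfl | rfl); exacts [he.inc_right, hf.inc_left])
      (by
        rw [disjoint_left]
        rintro _ (rfl | rfl)
        exacts [he.symm.notMem_edgeSet hle hv, hf.notMem_edgeSet hle hw])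
      hxG (by rw [hH.degree_attach, encard_pair hef]; norm_num)
    rcases this hg.inc_left with h | rfl | rfl
    · exact absurd (hg.mem_of_mem_incidenceSet hle h) hy
    · exact .inl ⟨rfl, hg.right_unique he.symm⟩
    · exact .inr ⟨rfl, hg.right_unique hf⟩
  · have := incidenceSet_subset_of_multiDegree (F := ∅) hle (empty_subset _)
      (empty_disjoint _) hxG (by simp [hH.degree_other x hx hxc])
    rw [union_empty] at this
    exact absurd (hg.mem_of_mem_incidenceSet hle (this hg.inc_left)) hy

/-- The edge from `c` to `c'` takes one of the two free places at each of them without leaving the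
vertex set, so just one outgoing edge remains at each. -/
theorem IsMiniBigadget.exists_isTwoEdgeCut {H : Graph α β} {c c' v w : α}
    (h4 : G.IsFourRegular) (hH : H.IsMiniBigadget c c') (hle : H ≤ G) (hv : v ∉ H.vertexSet)
    (hw : w ∉ H.vertexSet) (hvc : G.Adj v c)
    (hcc' : ∃ m, m ∉ H.edgeSet ∧ G.IsLink m c c') (hcw : G.Adj c' w) :
    ∃ e f, G.IsTwoEdgeCut H.vertexSet v w e f := by
  obtain ⟨e, he⟩ := hvc
  obtain ⟨m, hmH, hm⟩ := hcc'
  obtain ⟨f, hf⟩ := hcw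
  have hem : e ≠ m := by
    rintro rfl
    exact hv (hm.right_unique he.symm ▸ hH.mem')
  have hfm : f ≠ m := by
    rintro rfl
    exact hw (hm.symm.right_unique hf ▸ hH.mem)
  refine ⟨e, f, hle.vertexSet_mono, ⟨c, hH.mem, he.symm⟩, fun g x y hg hx hy => ?_⟩
  have hxG := h4 x hg.left_mem
  by_cases hxc : x = c
  · subst hxc
    have := incidenceSet_subset_of_multiDegree (F := {e, m}) hle
      (by rintro _ (rfl | rfl); exacts [he.inc_right, hm.inc_left])
      (by
        rw [disjoint_left]
        rintro _ (rfl | rfl)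
        exacts [he.symm.notMem_edgeSet hle hv, hmH])
      hxG (by rw [hH.degree_attach, encard_pair hem]; norm_num)
    rcases this hg.inc_left with h | rfl | rfl
    · exact absurd (hg.mem_of_mem_incidenceSet hle h) hy
    · exact .inl ⟨rfl, hg.right_unique he.symm⟩
    · exact absurd (hg.right_unique hm ▸ hH.mem') hy
  by_cases hxc' : x = c'
  · subst hxc'
    have := incidenceSet_subset_of_multiDegree (F := {f, m}) hle
      (by rintro _ (rfl | rfl); exacts [hf.inc_left, hm.inc_right])
      (by
        rw [disjoint_left]
        rintro _ (rfl | rfl)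
        exacts [hf.notMem_edgeSet hle hw, hmH])
      hxG (by rw [hH.degree_attach', encard_pair hfm]; norm_num)
    rcases this hg.inc_left with h | rfl | rfl
    · exact absurd (hg.mem_of_mem_incidenceSet hle h) hy
    · exact .inr ⟨rfl, hg.right_unique hf⟩
    · exact absurd (hg.right_unique hm.symm ▸ hH.mem) hy
  · have := incidenceSet_subset_of_multiDegree (F := ∅) hle (empty_subset _)
      (empty_disjoint _) hxG (by simp [hH.degree_other x hx hxc hxc'])
    rw [union_empty] at this
    exact absurd (hg.mem_of_mem_incidenceSet hle (this hg.inc_left)) hy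

/-! ### The representation of the pruned graph -/

theorem prune_isLink_inl {w : α} {v : Fin 2 → α} {H : Fin 2 → Graph α β} {e : β} {x y : α} :
    (G.prune w v H).IsLink (Sum.inl e) x y ↔
      G.IsLink e x y ∧ x ∉ (H 0).vertexSet ∪ (H 1).vertexSet ∧
        y ∉ (H 0).vertexSet ∪ (H 1).vertexSet :=
  deleteVerts_isLink G _

theorem prune_isLink_inr {w : α} {v : Fin 2 → α} {H : Fin 2 → Graph α β} {i : Fin 2} {x y : α} :
    (G.prune w v H).IsLink (Sum.inr i) x y ↔ (x = v i ∧ y = w) ∨ (x = w ∧ y = v i) :=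
  Iff.rfl

theorem IsGadgetFrame.vertexSet_prune {w : α} {v : Fin 2 → α} {H : Fin 2 → Graph α β}
    (h : G.IsGadgetFrame w v H) : (G.prune w v H).vertexSet =
      G.vertexSet \ ((H 0).vertexSet ∪ (H 1).vertexSet) := by
  change (G.deleteVerts _).vertexSet ∪ ({w} ∪ range v) = _
  rw [vertexSet_deleteVerts, union_eq_left]
  rintro x (rfl | ⟨i, rfl⟩)
  · exact ⟨(h.adj_v_w 0).right_mem, fun hx => hx.elim (h.w_notMem 0) (h.w_notMem 1)⟩
  · exact ⟨(h.adj_v_w i).left_mem, fun hx => hx.elim (h.v_notMem i 0) (h.v_notMem i 1)⟩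

theorem IsGadgetFrame.circleRepresentable_prune (hfin : G.vertexSet.Finite) {w : α}
    {v : Fin 2 → α} {H : Fin 2 → Graph α β} (hframe : G.IsGadgetFrame w v H)
    {e f : Fin 2 → β} (hcut : ∀ i, G.IsTwoEdgeCut (H i).vertexSet (v i) w (e i) (f i))
    (R : G.CircleRepresentation) : (G.prune w v H).CircleRepresentable := by
  set S := (H 0).vertexSet ∪ (H 1).vertexSet with hSdef
  have hSV : S ⊆ G.vertexSet := union_subset (hcut 0).subset (hcut 1).subset
  have hiS : ∀ i, (H i).vertexSet ⊆ S := by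
    rw [Fin.forall_fin_two]
    exact ⟨subset_union_left, subset_union_right⟩
  set D := doublePoints R.circles with hDdef
  have hvD : ∀ x ∈ G.vertexSet, R.vertexPoint x ∈ D := fun x hx => R.vertexPoint_bijOn.mapsTo hx
  -- Circles without any double point are discarded too.
  set 𝒞 : Set (Sphere ℂ) := {C ∈ R.circles | ∃ d ∈ D \ R.vertexPoint '' S, d ∈ C}
  have hpos : ∀ C ∈ 𝒞, 0 < C.radius := fun C hC => R.radius_pos C hC.1
  have hout : ∀ i, ∀ C ∈ 𝒞, ∃ d ∈ D \ R.vertexPoint '' (H i).vertexSet, d ∈ C := by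
    rintro i C ⟨-, d, hd, hdC⟩
    exact ⟨d, ⟨hd.1, fun h => hd.2 (image_mono (hiS i) h)⟩, hdC⟩
  have hlink : ∀ i, ∃ x y, G.IsLink (e i) x y := fun i => by
    obtain ⟨x, -, hx⟩ := (hcut i).exists_isLink
    exact ⟨_, _, hx⟩
  have harc : ∀ g x y, G.IsLink g x y → ∃ p q, IsArc R.circles (R.edgeArc g) p q :=
    fun g x y h => R.edgeArc_bijOn.mapsTo h.edge_mem
  have hD : doublePoints 𝒞 = D \ R.vertexPoint '' S := by
    ext p
    constructor
    · rintro ⟨C, hC, C', hC', hne, hp, hp'⟩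
      refine ⟨⟨C, hC.1, C', hC'.1, hne, hp, hp'⟩, fun hpS => ?_⟩
      obtain ⟨i, hpi⟩ : ∃ i, p ∈ R.vertexPoint '' (H i).vertexSet := by
        rw [hSdef, image_union] at hpS
        exact hpS.elim (fun h => ⟨0, h⟩) (fun h => ⟨1, h⟩)
      obtain ⟨s, -, rfl⟩ := exists_pt_eq (hpos C hC) hp 0
      obtain ⟨s', -, hs'⟩ := exists_pt_eq (hpos C' hC') hp' 0
      -- Both circles would contain the arc of `e i`, making its points double.
      obtain ⟨a, b, -, -, -, hsub⟩ :=
        R.exists_gap_through hfin (hcut i) hC.1 (hout i C hC) hpi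
      obtain ⟨a', b', -, -, -, hsub'⟩ :=
        R.exists_gap_through hfin (hcut i) hC'.1 (hout i C' hC') (hs' ▸ hpi)
      obtain ⟨x, y, hxy⟩ := hlink i
      obtain ⟨p, q, hA⟩ := harc _ _ _ hxy
      obtain ⟨z, hz⟩ := hA.nonempty
      refine disjoint_left.1 hA.disjoint hz ⟨C, hC.1, C', hC'.1, hne, ?_, ?_⟩
      · obtain ⟨t, -, rfl⟩ := hsub hz
        exact pt_mem (hpos C hC) t
      · obtain ⟨t, -, rfl⟩ := hsub' hz
        exact pt_mem (hpos C' hC') t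
    · rintro ⟨⟨C, hC, C', hC', hne, hp, hp'⟩, hpS⟩
      have hpD : p ∈ D := ⟨C, hC, C', hC', hne, hp, hp'⟩
      exact ⟨C, ⟨hC, p, ⟨hpD, hpS⟩, hp⟩, C', ⟨hC', p, ⟨hpD, hpS⟩, hp'⟩, hne, hp, hp'⟩
  have hvS : ∀ i, R.vertexPoint (v i) ∉ R.vertexPoint '' S := fun i => by
    rw [R.vertexPoint_mem_image_iff hSV (hframe.adj_v_w i).left_mem]
    exact fun hx => hx.elim (hframe.v_notMem i 0) (hframe.v_notMem i 1)
  have hwS : R.vertexPoint w ∉ R.vertexPoint '' S := by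
    rw [R.vertexPoint_mem_image_iff hSV (hframe.adj_v_w 0).right_mem]
    exact fun hx => hx.elim (hframe.w_notMem 0) (hframe.w_notMem 1)
  have hlong : ∀ i, ∀ C ∈ 𝒞, ∀ p ∈ C, p ∈ R.vertexPoint '' (H i).vertexSet →
      ∃ B, p ∈ B ∧ (IsArc 𝒞 B (R.vertexPoint (v i)) (R.vertexPoint w) ∨
        IsArc 𝒞 B (R.vertexPoint w) (R.vertexPoint (v i))) ∧ R.edgeArc (e i) ⊆ B ∧
        B ∩ D ⊆ R.vertexPoint '' (H i).vertexSet := by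
    intro i C hC p hpC hpi
    obtain ⟨s, -, rfl⟩ := exists_pt_eq (hpos C hC) hpC 0
    obtain ⟨a, b, hs, hgap, hends, hsub⟩ :=
      R.exists_gap_through hfin (hcut i) hC.1 (hout i C hC) hpi
    -- The gap avoids the double points outside `H i`, hence those outside `S`; its ends `v i` and
    -- `w` lie outside `S`, so they remain double points.
    have hgap' : IsGap (doublePoints 𝒞) C a b := by
      rw [hD]
      have hab : pt C a ∉ R.vertexPoint '' S ∧ pt C b ∉ R.vertexPoint '' S := by
        rcases hends with ⟨h1, h2⟩ | ⟨h1, h2⟩ <;> rw [h1, h2]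
        exacts [⟨hvS i, hwS⟩, ⟨hwS, hvS i⟩]
      exact .of_lt hgap.lt ⟨hgap.left_mem.1, hab.1⟩ ⟨hgap.right_mem.1, hab.2⟩
        fun t ht h => hgap.notMem t ht ⟨h.1, fun h' => h.2 (image_mono (hiS i) h')⟩
    refine ⟨arc C a b, ⟨s, hs, rfl⟩, ?_, hsub, ?_⟩
    · exact hends.imp
        (fun h => isArc_iff.2 ⟨C, hC, a, b, hgap', h.1, h.2, rfl⟩)
        (fun h => isArc_iff.2 ⟨C, hC, a, b, hgap', h.1, h.2, rfl⟩)
    · rintro _ ⟨⟨t, ht, rfl⟩, htD⟩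
      exact by_contra fun h => hgap.notMem t ht ⟨htD, h⟩
  -- The circle carrying the edge `e i` is kept because it passes through `v i`, and it provides the
  -- arc of the new edge.
  have hB : ∀ i, ∃ B, (∃ p ∈ B, p ∈ R.vertexPoint '' (H i).vertexSet) ∧
      (IsArc 𝒞 B (R.vertexPoint (v i)) (R.vertexPoint w) ∨
        IsArc 𝒞 B (R.vertexPoint w) (R.vertexPoint (v i))) ∧ R.edgeArc (e i) ⊆ B ∧
        B ∩ D ⊆ R.vertexPoint '' (H i).vertexSet := by
    intro i
    obtain ⟨x, hxS, hx⟩ := (hcut i).exists_isLink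
    obtain ⟨C, hC, hxC, hvC⟩ : ∃ C ∈ R.circles, R.vertexPoint x ∈ C ∧ R.vertexPoint (v i) ∈ C := by
      rcases R.isArc_of_isLink _ _ _ hx with h | h <;>
      · obtain ⟨C, hC, a, b, -, ha, hb, -⟩ := isArc_iff.1 h
        refine ⟨C, hC, ?_⟩
        rw [← ha, ← hb]
        exact ⟨pt_mem (R.radius_pos C hC) _, pt_mem (R.radius_pos C hC) _⟩
    have hC𝒞 : C ∈ 𝒞 := ⟨hC, _, ⟨hvD _ hx.right_mem, hvS i⟩, hvC⟩
    obtain ⟨B, hxB, hB⟩ := hlong i C hC𝒞 _ hxC (mem_image_of_mem _ hxS)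
    exact ⟨B, ⟨_, hxB, mem_image_of_mem _ hxS⟩, hB⟩
  choose B hBmem hBarc hBe hBD using hB
  have hBarc' : ∀ i, ∃ p q, IsArc 𝒞 (B i) p q := fun i =>
    (hBarc i).elim (fun h => ⟨_, _, h⟩) fun h => ⟨_, _, h⟩
  have hYD : ∀ i, R.vertexPoint '' (H i).vertexSet ⊆ D := by
    rintro i _ ⟨x, hx, rfl⟩
    exact hvD x ((hcut i).subset hx)
  -- Passing to fewer double points cannot cut an arc, and an end outside `S` guarantees that its
  -- circle is kept.
  have hold : ∀ A p q, IsArc R.circles A p q → p ∉ R.vertexPoint '' S → q ∉ R.vertexPoint '' S →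
      IsArc 𝒞 A p q := by
    intro A p q hA hp hq
    obtain ⟨C, hC, a, b, hgap, rfl, rfl, rfl⟩ := isArc_iff.1 hA
    refine isArc_iff.2 ⟨C, ⟨hC, _, ⟨hgap.left_mem, hp⟩, pt_mem (R.radius_pos C hC) a⟩, a, b,
      ?_, rfl, rfl, rfl⟩
    rw [hD]
    exact .of_lt hgap.lt ⟨hgap.left_mem, hp⟩ ⟨hgap.right_mem, hq⟩
      fun t ht h => hgap.notMem t ht h.1
  have hold' : ∀ g x y, (G.prune w v H).IsLink (Sum.inl g) x y →
      IsArc 𝒞 (R.edgeArc g) (R.vertexPoint x) (R.vertexPoint y) ∨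
        IsArc 𝒞 (R.edgeArc g) (R.vertexPoint y) (R.vertexPoint x) := by
    intro g x y h
    obtain ⟨hg, hx, hy⟩ := prune_isLink_inl.1 h
    rw [← hSdef, ← R.vertexPoint_mem_image_iff hSV hg.left_mem] at hx
    rw [← hSdef, ← R.vertexPoint_mem_image_iff hSV hg.right_mem] at hy
    exact (R.isArc_of_isLink g x y hg).imp (fun h => hold _ _ _ h hx hy)
      fun h => hold _ _ _ h hy hx
  have hinl : ∀ g, Sum.inl g ∈ (G.prune w v H).edgeSet →
      g ∈ G.edgeSet ∧ Disjoint (R.edgeArc g) D := by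
    intro g hg
    obtain ⟨x, y, hxy⟩ := exists_isLink_of_mem_edgeSet hg
    have hxy' := (prune_isLink_inl.1 hxy).1
    obtain ⟨p, q, hA⟩ := harc _ _ _ hxy'
    exact ⟨hxy'.edge_mem, hA.disjoint⟩
  have hinlr : ∀ g i, Sum.inl g ∈ (G.prune w v H).edgeSet → R.edgeArc g ≠ B i := by
    intro g i hg heq
    obtain ⟨p, hp, hpi⟩ := hBmem i
    exact disjoint_left.1 (hinl g hg).2 (heq ▸ hp) (hYD i hpi)
  have hdisj : ∀ i j, (R.vertexPoint '' (H i).vertexSet ∩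
      R.vertexPoint '' (H j).vertexSet).Nonempty → i = j := by
    have key : ¬ (R.vertexPoint '' (H 0).vertexSet ∩
        R.vertexPoint '' (H 1).vertexSet).Nonempty := by
      rintro ⟨_, ⟨x, hx, rfl⟩, hx'⟩
      rw [R.vertexPoint_mem_image_iff (hcut 1).subset ((hcut 0).subset hx)] at hx'
      exact disjoint_left.1 hframe.disjoint hx hx'
    intro i j h
    fin_cases i <;> fin_cases j
    · rfl
    · exact absurd h key
    · exact absurd (inter_comm _ _ ▸ h) key
    · rfl
  refine ⟨{
    circles := 𝒞
    radius_pos := hpos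
    at_most_two := fun p => (encard_le_encard fun _ hC => And.imp_left And.left hC).trans (R.at_most_two p)
    vertexPoint := R.vertexPoint
    vertexPoint_bijOn := ?_
    edgeArc := Sum.elim R.edgeArc B
    edgeArc_bijOn := ⟨?_, ?_, ?_⟩
    isArc_of_isLink := ?_ }⟩
  · rw [hframe.vertexSet_prune, hD, hDdef, ← R.vertexPoint_bijOn.image_eq,
      ← R.vertexPoint_bijOn.injOn.image_sdiff_subset hSV]
    exact (R.vertexPoint_bijOn.injOn.mono sdiff_subset).bijOn_image
  · rintro (g | i) hg
    · obtain ⟨x, y, hxy⟩ := exists_isLink_of_mem_edgeSet hg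
      exact (hold' g x y hxy).elim (fun h => ⟨_, _, h⟩) fun h => ⟨_, _, h⟩
    · exact hBarc' i
  · rintro (g | i) hg (g' | i') hg' heq
    · exact congrArg _ (R.edgeArc_bijOn.injOn (hinl g hg).1 (hinl g' hg').1 heq)
    · exact absurd heq (hinlr g i' hg)
    · exact absurd heq.symm (hinlr g' i hg')
    · obtain ⟨p, hp, hpi⟩ := hBmem i
      have hp' : p ∈ B i' := (show B i = B i' from heq) ▸ hp
      -- All former double points on `B i'` belong to `H i'`, whereas `B i` contains one of `H i`;
      -- the two gadgets are disjoint.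
      exact congrArg _ (hdisj i i' ⟨p, hpi, hBD i' ⟨hp', hYD i hpi⟩⟩)
  · rintro A ⟨p, q, hA⟩
    obtain ⟨C, hC, a, b, hgap, rfl, rfl, rfl⟩ := isArc_iff.1 hA
    have hgapD := hgap
    rw [hD] at hgapD
    -- An arc containing a former double point passes through some `H i` and thus equals `B i`, as
    -- both contain the arc of `e i`. Any other arc was already an arc of `R`.
    by_cases hs : ∃ s ∈ Ioo a b, pt C s ∈ D
    · obtain ⟨s, hs, hsD⟩ := hs
      have hsS : pt C s ∈ R.vertexPoint '' S := by_contra fun h => hgapD.notMem s hs ⟨hsD, h⟩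
      obtain ⟨i, hsi⟩ : ∃ i, pt C s ∈ R.vertexPoint '' (H i).vertexSet := by
        rw [hSdef, image_union] at hsS
        exact hsS.elim (fun h => ⟨0, h⟩) (fun h => ⟨1, h⟩)
      obtain ⟨B', hsB', hB'arc, hB'e, -⟩ := hlong i C hC _ (pt_mem (hpos C hC) s) hsi
      obtain ⟨p', q', hB'⟩ : ∃ p q, IsArc 𝒞 B' p q :=
        hB'arc.elim (fun h => ⟨_, _, h⟩) fun h => ⟨_, _, h⟩
      obtain ⟨p'', q'', hBi⟩ := hBarc' i
      obtain ⟨x, y, hxy⟩ := hlink i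
      obtain ⟨_, _, he⟩ := harc _ _ _ hxy
      obtain ⟨z, hz⟩ := he.nonempty
      refine ⟨Sum.inr i, (prune_isLink_inr.2 (.inl ⟨rfl, rfl⟩)).edge_mem, ?_⟩
      rw [Sum.elim_inr, (hBi.eq_of_mem hpos hB' (hBe i hz) (hB'e hz)).1]
      exact (hB'.eq_of_mem hpos hA hsB' ⟨s, hs, rfl⟩).1
    · push Not at hs
      obtain ⟨g, x, y, hxy, hg, hx, hy⟩ := R.exists_isLink_of_isGap hC.1
        (.of_lt hgapD.lt hgapD.left_mem.1 hgapD.right_mem.1 hs)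
      refine ⟨Sum.inl g, (prune_isLink_inl.2 ⟨hxy, ?_, ?_⟩).edge_mem, hg⟩
      · exact fun h => hgapD.left_mem.2 (hx ▸ mem_image_of_mem _ h)
      · exact fun h => hgapD.right_mem.2 (hy ▸ mem_image_of_mem _ h)
  · rintro (g | i) x y hxy
    · exact hold' g x y hxy
    · rcases prune_isLink_inr.1 hxy with ⟨rfl, rfl⟩ | ⟨rfl, rfl⟩
      · exact hBarc i
      · exact (hBarc i).symm

end Graph

/-- Pruning: if a finite 4-regular multigraph `G` with a specified gadget-subgraph or
bigadget-subgraph has a circle representation, so does the multigraph obtained by removing the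
two mini-(bi)gadgets and adding an edge `v i — w` for each `i`.  Planarity of `G` is not listed
as a hypothesis, since a multigraph with a circle representation is planar. -/
theorem mainTheorem3 {α β : Type*} (G : Graph α β) (hfin : G.vertexSet.Finite)
    (h4 : G.IsFourRegular) (w : α) (v : Fin 2 → α) (H : Fin 2 → Graph α β)
    (hgadget : (∃ c : Fin 2 → α, G.IsGadgetSubgraph w v c H) ∨
      (∃ c c' : Fin 2 → α, G.IsBigadgetSubgraph w v c c' H))
    (hG : G.CircleRepresentable) :
    (G.prune w v H).CircleRepresentable := by
  obtain ⟨R⟩ := hG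
  rcases hgadget with ⟨c, h⟩ | ⟨c, c', h⟩
  · choose e f hcut using fun i => (h.mini i).exists_isTwoEdgeCut h4 (h.le i) (h.v_notMem i i)
      (h.w_notMem i) (h.v_ne_w i) (h.adj_v_c i) (h.adj_c_w i)
    exact h.toIsGadgetFrame.circleRepresentable_prune hfin hcut R
  · choose e f hcut using fun i => (h.mini i).exists_isTwoEdgeCut h4 (h.le i) (h.v_notMem i i)
      (h.w_notMem i) (h.adj_v_c i) (h.link_c_c' i) (h.adj_c'_w i)
    exact h.toIsGadgetFrame.circleRepresentable_prune hfin hcut R
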